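/- Let $BW\in\mathbb R$ (the bandwidth), $m_1,m_2>0$ and $\Omega>0$. For $j=1,2$ let $N_j$ be a Nakagami coefficient, i.e. $N_j^2$ has density $\frac{m_j^{m_j}x^{m_j-1}}{\Omega^{m_j}\Gamma(m_j)}e^{-m_jx/\Omega}$ on $x>0$. An inverse-gamma variable with shape $\alpha$ and scale $\beta$ has density $\frac{\beta^{\alpha}}{\Gamma(\alpha)y^{\alpha+1}}e^{-\beta/y}$ on $y>0$. The ergodic capacity of a channel with random received SNR $\gamma$ is $\bar C=BW\cdot\mathbb E[\log_2(1+\gamma)]$. Meijer's G-function is $$G^{m,n}_{p,q}\Big(z\,\Big|\,{a_1,\dots,a_p\atop b_1,\dots,b_q}\Big)=\frac1{2\pi i}\int_{\sigma-i\infty}^{\sigma+i\infty}\frac{\prod_{j=1}^m\Gamma(b_j-s)\prod_{j=1}^n\Gamma(1-a_j+s)}{\prod_{j=m+1}^q\Gamma(1-b_j+s)\prod_{j=n+1}^p\Gamma(a_j-s)}\,z^s\,ds,$$ where the line $\mathrm{Re}\,s=\sigma$ separates the poles of the $\Gamma(b_j-s)$, $j\le m$ (on its right), from those of the $\Gamma(1-a_j+s)$,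 $j\le n$ (on its left). (Double shadowing.) Let $\gamma=(N_1^2I_1)(N_2^2I_2)$, where $I_j$ is inverse-gamma with shape $\alpha_j>1$ and scale $\bar\gamma_j>0$, $N_j^2$ is independent of $I_j$ for $j=1,2$, and $N_1^2I_1$ is independent of $N_2^2I_2$. Put $\bar\gamma=\Omega^2\bar\gamma_1\bar\gamma_2$, $\tilde\gamma=m_1m_2/\bar\gamma$ and $\mathcal S_1=\frac1{\Gamma(m_1)\Gamma(m_2)\Gamma(\alpha_1)\Gamma(\alpha_2)}$. Then $\log_2(1+\gamma)$ is integrable and $$\bar C=BW\,\mathcal S_1\,(\ln 2)^{-1}\,G^{4,3}_{4,4}\Big(\tilde\gamma\,\Big|\,{1-\alpha_2,\,1-\alpha_1,\,0,\,1\atop m_1,\,m_2,\,0,\,0}\Big).$$ (Single shadowing.) Let $\gamma=(N_1N_2)^2I$, where $I$ is inverse-gamma with shape $\alpha>1$ and scale $\beta>0$, $N_1^2$ and $N_2^2$ are independent, and $(N_1N_2)^2$ is independent of $I$. Put $\bar\gamma=\Omega^2\beta$, $\tilde\gamma=m_1m_2/\bar\gamma$ and $\mathcal S_2=\frac1{\Gamma(m_1)\Gamma(m_2)\Gamma(\alpha)}$.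 Then $\log_2(1+\gamma)$ is integrable and $$\bar C=BW\,\mathcal S_2\,(\ln 2)^{-1}\,G^{4,2}_{3,4}\Big(\tilde\gamma\,\Big|\,{1-\alpha,\,0,\,1\atop m_1,\,m_2,\,0,\,0}\Big).$$ In both cases a separating line exists, and the integral defining the G-function converges absolutely along every separating line, with a value that does not depend on the line. -/

import Mathlib

open MeasureTheory ProbabilityTheory

noncomputable section

namespace ShadowedDoubleScattering

/-! ### Meijer's G-function -/

/-- The integrand of the Mellin-Barnes integral of `G^{m,n}_{p,q}(z | a; b)`:
`∏_{j ≤ m} Γ(b_j - s) ∏_{j ≤ n} Γ(1 - a_j + s) /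
  (∏_{j > m} Γ(1 - b_j + s) ∏_{j > n} Γ(a_j - s)) * z ^ s`.
Indices start at `0` here, so `j ≤ m` reads `j < m`. At a pole of a gamma factor in the
denominator Mathlib's conventions give `1 / Γ = 0`, which is the value of the entire
function `1 / Γ` there. -/
def meijerGIntegrand {p q : ℕ} (m n : ℕ) (a : Fin p → ℂ) (b : Fin q → ℂ) (z s : ℂ) : ℂ :=
  ((∏ j : Fin q, if (j : ℕ) < m then Complex.Gamma (b j - s) else 1) *
      (∏ j : Fin p, if (j : ℕ) < n then Complex.Gamma (1 - a j + s) else 1)) /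
    ((∏ j : Fin q, if (j : ℕ) < m then 1 else Complex.Gamma (1 - b j + s)) *
      (∏ j : Fin p, if (j : ℕ) < n then 1 else Complex.Gamma (a j - s))) * z ^ s

/-- The line `Re s = σ` separates the poles `b_j + k` (`j ≤ m`, `k ∈ ℕ`) of the factors
`Γ(b_j - s)`, on its right, from the poles `a_j - 1 - k` (`j ≤ n`, `k ∈ ℕ`) of the factors
`Γ(1 - a_j + s)`, on its left. -/
def SeparatesPoles {p q : ℕ} (m n : ℕ) (a : Fin p → ℂ) (b : Fin q → ℂ) (σ : ℝ) : Prop :=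
  (∀ j : Fin q, (j : ℕ) < m → σ < (b j).re) ∧ (∀ j : Fin p, (j : ℕ) < n → (a j).re - 1 < σ)

/-- The Mellin-Barnes integral `(2πi)⁻¹ ∫ …` along the upward line `Re s = σ`; the factor
`i` of `ds = i dt` cancels that of `2πi`. -/
def meijerGLine {p q : ℕ} (m n : ℕ) (a : Fin p → ℂ) (b : Fin q → ℂ) (z : ℂ) (σ : ℝ) : ℂ :=
  (2 * (Real.pi : ℂ))⁻¹ * ∫ t : ℝ, meijerGIntegrand m n a b z ((σ : ℂ) + (t : ℂ) * Complex.I)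

open Classical in
/-- Meijer's G-function `G^{m,n}_{p,q}(z | a; b)`, as the Mellin-Barnes integral along a
vertical line that separates the two families of poles (`0` by convention if there is no
such line). See `MeijerGWellDefined` for its independence of the line. -/
def meijerG {p q : ℕ} (m n : ℕ) (a : Fin p → ℂ) (b : Fin q → ℂ) (z : ℂ) : ℂ :=
  if h : ∃ σ : ℝ, SeparatesPoles m n a b σ then meijerGLine m n a b z h.choose else 0

/-- The Mellin-Barnes definition of `G^{m,n}_{p,q}(z | a; b)` makes sense: a separating line
exists, and along every separating line the integral converges absolutely and has the value
`meijerG m n a b z`. -/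
def MeijerGWellDefined {p q : ℕ} (m n : ℕ) (a : Fin p → ℂ) (b : Fin q → ℂ) (z : ℂ) : Prop :=
  (∃ σ : ℝ, SeparatesPoles m n a b σ) ∧
    ∀ σ : ℝ, SeparatesPoles m n a b σ →
      Integrable (fun t : ℝ => meijerGIntegrand m n a b z ((σ : ℂ) + (t : ℂ) * Complex.I)) ∧
        meijerGLine m n a b z σ = meijerG m n a b z

/-! ### The channel model -/

/-- The law of the square of a Nakagami-`m` variable with mean square `Ω`: its density is
`m ^ m x ^ (m - 1) / (Ω ^ m Γ(m)) * exp (- m x / Ω)` on `x > 0`, that is, the gamma law of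
shape `m` and rate `m / Ω`. -/
def nakagamiSqMeasure (m Ω : ℝ) : Measure ℝ := gammaMeasure m (m / Ω)

/-- The density of the inverse-gamma law with shape `α` and scale `β`. -/
def invGammaPDFReal (α β y : ℝ) : ℝ :=
  if 0 < y then β ^ α / (Real.Gamma α * y ^ (α + 1)) * Real.exp (-(β / y)) else 0

/-- The inverse-gamma law with shape `α` and scale `β`. -/
def invGammaMeasure (α β : ℝ) : Measure ℝ :=
  volume.withDensity fun y => ENNReal.ofReal (invGammaPDFReal α β y)

/-- The ingredients of the double-shadowing channel: Nakagami fading coefficients `N₁`, `N₂`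
and inverse-gamma shadowing coefficients `I₁`, `I₂`; fading and shadowing are independent
within each scattering region, and the SNR factors of the two regions are independent. -/
structure IsDoubleShadowing {S : Type*} [MeasurableSpace S] (P : Measure S)
    (N₁ N₂ I₁ I₂ : S → ℝ) (m₁ m₂ Ω α₁ α₂ β₁ β₂ : ℝ) : Prop where
  law_N₁ : HasLaw (fun ω => N₁ ω ^ 2) (nakagamiSqMeasure m₁ Ω) P
  law_N₂ : HasLaw (fun ω => N₂ ω ^ 2) (nakagamiSqMeasure m₂ Ω) P
  law_I₁ : HasLaw I₁ (invGammaMeasure α₁ β₁) P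
  law_I₂ : HasLaw I₂ (invGammaMeasure α₂ β₂) P
  indep₁ : IndepFun (fun ω => N₁ ω ^ 2) I₁ P
  indep₂ : IndepFun (fun ω => N₂ ω ^ 2) I₂ P
  indep : IndepFun (fun ω => N₁ ω ^ 2 * I₁ ω) (fun ω => N₂ ω ^ 2 * I₂ ω) P

/-- The ingredients of the single-shadowing channel: Nakagami fading coefficients `N₁`, `N₂`
with independent squares, and one inverse-gamma shadowing coefficient `I`, independent of the
double-scattering factor `(N₁ N₂) ^ 2`. -/
structure IsSingleShadowing {S : Type*} [MeasurableSpace S] (P : Measure S)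
    (N₁ N₂ I : S → ℝ) (m₁ m₂ Ω α β : ℝ) : Prop where
  law_N₁ : HasLaw (fun ω => N₁ ω ^ 2) (nakagamiSqMeasure m₁ Ω) P
  law_N₂ : HasLaw (fun ω => N₂ ω ^ 2) (nakagamiSqMeasure m₂ Ω) P
  law_I : HasLaw I (invGammaMeasure α β) P
  indep_N : IndepFun (fun ω => N₁ ω ^ 2) (fun ω => N₂ ω ^ 2) P
  indep : IndepFun (fun ω => (N₁ ω * N₂ ω) ^ 2) I P

/-- The received SNR of the double-shadowing channel. -/
def snrDS {S : Type*} (N₁ N₂ I₁ I₂ : S → ℝ) (ω : S) : ℝ :=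
  (N₁ ω ^ 2 * I₁ ω) * (N₂ ω ^ 2 * I₂ ω)

/-- The received SNR of the single-shadowing channel. -/
def snrSS {S : Type*} (N₁ N₂ I : S → ℝ) (ω : S) : ℝ :=
  (N₁ ω * N₂ ω) ^ 2 * I ω

/-- The ergodic capacity `BW * E[log₂ (1 + γ)]`. -/
def ergodicCapacity {S : Type*} [MeasurableSpace S] (P : Measure S) (BW : ℝ) (γ : S → ℝ) : ℝ :=
  BW * ∫ ω, Real.logb 2 (1 + γ ω) ∂P

/-- The normalising constant `1 / (Γ(m₁) Γ(m₂) Γ(α₁) Γ(α₂))`. -/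
def constDS (m₁ m₂ α₁ α₂ : ℝ) : ℝ :=
  1 / (Real.Gamma m₁ * Real.Gamma m₂ * Real.Gamma α₁ * Real.Gamma α₂)

/-- The normalising constant `1 / (Γ(m₁) Γ(m₂) Γ(α))`. -/
def constSS (m₁ m₂ α : ℝ) : ℝ :=
  1 / (Real.Gamma m₁ * Real.Gamma m₂ * Real.Gamma α)

end ShadowedDoubleScattering

end

/-! On the strip `-1 < Re s < 0` the Mellin transform of `log (1 + x)` is
`Γ(-s) Γ(1 + s) / (-s)`: integrating by parts reduces it to that of `1 / (1 + x)`, the Laplace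
transform of `exp (-t)`. By the reflection formula it equals `π / (s sin (π s))`, which is
integrable along vertical lines, so Mellin inversion and Fubini write `E[log (1 + γ)]` as the line
integral of this kernel times `E[γ ^ (-s)]`. Independence factors the latter into complex moments
of gamma and inverse-gamma laws, which are quotients of gamma functions, and the product is the
Mellin-Barnes integrand. -/

namespace ShadowedDoubleScattering

open Filter Topology Set Asymptotics
open Complex (Gamma I)

section Mellin

theorem hasMellin_congr {f g : ℝ → ℂ} {s m : ℂ} (h : EqOn f g (Ioi 0)) :
    HasMellin f s m ↔ HasMellin g s m := by
  have hfg : EqOn (fun t : ℝ => (t : ℂ) ^ (s - 1) • f t) (fun t => (t : ℂ) ^ (s - 1) • g t)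
      (Ioi 0) := fun t ht => by simp only [h ht]
  rw [HasMellin, HasMellin, MellinConvergent, MellinConvergent, mellin, mellin,
    integrableOn_congr_fun hfg measurableSet_Ioi, setIntegral_congr_fun measurableSet_Ioi hfg]

theorem hasMellin_exp_neg_mul {r : ℝ} (hr : 0 < r) {s : ℂ} (hs : 0 < s.re) :
    HasMellin (fun x : ℝ => (Real.exp (-(r * x)) : ℂ)) s ((r : ℂ) ^ (-s) * Gamma s) := by
  have hconv : MellinConvergent (fun x : ℝ => (Real.exp (-x) : ℂ)) s :=
    (Complex.GammaIntegral_convergent hs).congr_fun (fun x _ => mul_comm _ _) measurableSet_Ioi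
  refine ⟨(MellinConvergent.comp_mul_left hr).2 hconv, ?_⟩
  rw [mellin_comp_mul_left (fun x : ℝ => (Real.exp (-x) : ℂ)) s hr, smul_eq_mul,
    Complex.Gamma_eq_integral hs, Complex.GammaIntegral_eq_mellin]

theorem hasMellin_cpow_mul_exp_neg_mul {r : ℝ} (hr : 0 < r) {s w : ℂ} (hs : 0 < (s + w).re) :
    HasMellin (fun x : ℝ => (x : ℂ) ^ w * (Real.exp (-(r * x)) : ℂ)) s
      ((r : ℂ) ^ (-(s + w)) * Gamma (s + w)) := by
  obtain ⟨hconv, hval⟩ := hasMellin_exp_neg_mul hr hs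
  exact ⟨MellinConvergent.cpow_smul.2 hconv, (mellin_cpow_smul _ s w).trans hval⟩

theorem hasMellin_cpow_mul_exp_neg_mul_inv {r : ℝ} (hr : 0 < r) {s w : ℂ}
    (hs : (s + w).re < 0) :
    HasMellin (fun x : ℝ => (x : ℂ) ^ w * (Real.exp (-(r * x⁻¹)) : ℂ)) s
      ((r : ℂ) ^ (s + w) * Gamma (-(s + w))) := by
  obtain ⟨hconv, hval⟩ := hasMellin_exp_neg_mul hr (s := -(s + w)) (neg_pos.2 hs)
  refine ⟨MellinConvergent.cpow_smul.2 ?_, (mellin_cpow_smul _ s w).trans ?_⟩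
  · have h := (MellinConvergent.comp_rpow (f := fun x : ℝ => (Real.exp (-(r * x)) : ℂ))
      (s := s + w) (a := -1) (by norm_num)).2 (by simpa [div_neg] using hconv)
    simpa only [Real.rpow_neg_one] using h
  · rw [mellin_comp_inv (fun x : ℝ => (Real.exp (-(r * x)) : ℂ)), hval, neg_neg]

theorem integrable_prod_cpow_mul_exp_neg_mul {g : ℝ → ℂ} {s : ℂ} (hs : 0 < s.re)
    (hg : MellinConvergent g (1 - s)) :
    Integrable (Function.uncurry fun x t : ℝ =>
        (x : ℂ) ^ (s - 1) * ((Real.exp (-(t * x)) : ℂ) * g t))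
      ((volume.restrict (Ioi 0)).prod (volume.restrict (Ioi 0))) := by
  have hpow : ∀ᵐ t ∂volume.restrict (Ioi (0 : ℝ)),
      g t = (t : ℂ) ^ s * ((t : ℂ) ^ (1 - s - 1) • g t) := by
    filter_upwards [ae_restrict_mem measurableSet_Ioi] with t ht
    have ht' : (t : ℂ) ≠ 0 := Complex.ofReal_ne_zero.2 (ne_of_gt ht)
    rw [smul_eq_mul, ← mul_assoc, ← Complex.cpow_add _ _ ht', show s + (1 - s - 1) = 0 by ring,
      Complex.cpow_zero, one_mul]
  have hg_meas : AEStronglyMeasurable g (volume.restrict (Ioi 0)) :=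
    ((Measurable.aestronglyMeasurable (by fun_prop)).mul hg.aestronglyMeasurable).congr
      (hpow.mono fun t ht => ht.symm)
  have hmeas : AEStronglyMeasurable (Function.uncurry fun x t : ℝ =>
      (x : ℂ) ^ (s - 1) * ((Real.exp (-(t * x)) : ℂ) * g t))
      ((volume.restrict (Ioi 0)).prod (volume.restrict (Ioi 0))) :=
    (Measurable.aestronglyMeasurable (by fun_prop)).mul
      ((Measurable.aestronglyMeasurable (by fun_prop)).mul hg_meas.comp_snd)
  refine (integrable_prod_iff' hmeas).2 ⟨?_, (hg.norm.const_mul (Real.Gamma s.re)).congr ?_⟩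
  · filter_upwards [ae_restrict_mem measurableSet_Ioi] with t ht
    exact ((hasMellin_exp_neg_mul ht hs).1.mul_const (g t)).congr
      (Eventually.of_forall fun x => mul_assoc _ _ _)
  · filter_upwards [ae_restrict_mem measurableSet_Ioi] with t (ht : 0 < t)
    have hnorm : EqOn (fun x : ℝ => ‖(x : ℂ) ^ (s - 1) * ((Real.exp (-(t * x)) : ℂ) * g t)‖)
        (fun x => x ^ (s.re - 1) * Real.exp (-(t * x)) * ‖g t‖) (Ioi 0) := fun x hx => by
      simp only [norm_mul, Complex.norm_cpow_eq_rpow_re_of_pos hx, Complex.norm_real,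
        Real.norm_eq_abs, Real.abs_exp, Complex.sub_re, Complex.one_re, mul_assoc]
    simp only [Function.uncurry]
    rw [setIntegral_congr_fun measurableSet_Ioi hnorm, integral_mul_const,
      Real.integral_rpow_mul_exp_neg_mul_Ioi hs ht, norm_smul,
      Complex.norm_cpow_eq_rpow_re_of_pos ht, one_div, Real.inv_rpow ht.le,
      ← Real.rpow_neg ht.le]
    simp only [Complex.sub_re, Complex.one_re]
    ring_nf

theorem hasMellin_integral_exp_neg_mul {g : ℝ → ℂ} {s : ℂ} (hs : 0 < s.re)
    (hg : MellinConvergent g (1 - s)) :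
    HasMellin (fun x : ℝ => ∫ t in Ioi (0 : ℝ), (Real.exp (-(t * x)) : ℂ) * g t) s
      (Gamma s * mellin g (1 - s)) := by
  have hint := integrable_prod_cpow_mul_exp_neg_mul hs hg
  constructor
  · refine hint.integral_prod_left.congr (Eventually.of_forall fun x => ?_)
    exact integral_const_mul ((x : ℂ) ^ (s - 1)) _
  calc
    _ = ∫ x in Ioi (0 : ℝ), ∫ t in Ioi (0 : ℝ),
          (x : ℂ) ^ (s - 1) * ((Real.exp (-(t * x)) : ℂ) * g t) := by
      simp only [mellin, smul_eq_mul, integral_const_mul]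
    _ = ∫ t in Ioi (0 : ℝ), ∫ x in Ioi (0 : ℝ),
          (x : ℂ) ^ (s - 1) * ((Real.exp (-(t * x)) : ℂ) * g t) := integral_integral_swap hint
    _ = ∫ t in Ioi (0 : ℝ), Gamma s * ((t : ℂ) ^ (1 - s - 1) • g t) := by
      refine setIntegral_congr_fun measurableSet_Ioi fun t ht => ?_
      have hval := (hasMellin_exp_neg_mul ht hs).2
      simp only [mellin, smul_eq_mul] at hval
      simp only [← mul_assoc, integral_mul_const, hval, smul_eq_mul]
      ring_nf
    _ = _ := integral_const_mul _ _

theorem hasMellin_inv_one_add {s : ℂ} (h0 : 0 < s.re) (h1 : s.re < 1) :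
    HasMellin (fun x : ℝ => ((1 + x : ℝ) : ℂ)⁻¹) s (Gamma s * Gamma (1 - s)) := by
  have hexp := hasMellin_exp_neg_mul one_pos (s := 1 - s) (by simpa using h1)
  have hlaplace := hasMellin_integral_exp_neg_mul h0 hexp.1
  rw [hexp.2, Complex.ofReal_one, Complex.one_cpow, one_mul] at hlaplace
  refine (hasMellin_congr fun x (hx : 0 < x) => ?_).1 hlaplace
  have hcombine : ∀ t : ℝ, (Real.exp (-(t * x)) : ℂ) * (Real.exp (-(1 * t)) : ℂ) =
      (Real.exp (-(1 + x) * t) : ℂ) := fun t => by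
    rw [← Complex.ofReal_mul, ← Real.exp_add]
    ring_nf
  simp only [hcombine]
  rw [integral_complex_ofReal, integral_exp_mul_Ioi (by linarith)]
  simp [neg_div, div_neg, -neg_add_rev]

theorem isBigO_cpow_rpow_re {l : Filter ℝ} (hl : ∀ᶠ x in l, 0 < x) (s : ℂ) :
    (fun x : ℝ => (x : ℂ) ^ s) =O[l] fun x => x ^ s.re := by
  refine IsBigO.of_bound 1 (hl.mono fun x hx => ?_)
  rw [Complex.norm_cpow_eq_rpow_re_of_pos hx, one_mul]
  exact le_abs_self _

theorem tendsto_mul_cpow_atTop_of_isBigO {f : ℝ → ℂ} {s : ℂ} {a : ℝ}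
    (hf : f =O[atTop] fun x => x ^ (-a)) (ha : s.re < a) :
    Tendsto (fun x : ℝ => f x * (x : ℂ) ^ s) atTop (𝓝 0) := by
  refine (hf.mul (isBigO_cpow_rpow_re (eventually_gt_atTop 0) s)).trans_tendsto ?_
  refine (tendsto_rpow_neg_atTop (sub_pos.2 ha)).congr' ?_
  filter_upwards [eventually_gt_atTop 0] with x hx
  rw [← Real.rpow_add hx, neg_sub, neg_add_eq_sub]

theorem tendsto_mul_cpow_nhdsGT_zero_of_isBigO {f : ℝ → ℂ} {s : ℂ} {b : ℝ}
    (hf : f =O[𝓝[>] 0] fun x => x ^ (-b)) (hb : b < s.re) :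
    Tendsto (fun x : ℝ => f x * (x : ℂ) ^ s) (𝓝[>] 0) (𝓝 0) := by
  refine (hf.mul (isBigO_cpow_rpow_re self_mem_nhdsWithin s)).trans_tendsto ?_
  have hpow := (Real.continuousAt_rpow_const 0 (s.re - b) (Or.inr (sub_pos.2 hb).le)).tendsto
  rw [Real.zero_rpow (sub_pos.2 hb).ne'] at hpow
  refine (hpow.mono_left nhdsWithin_le_nhds).congr' ?_
  filter_upwards [self_mem_nhdsWithin] with x hx
  rw [← Real.rpow_add hx, neg_add_eq_sub]

theorem hasMellin_of_hasDerivAt {f f' : ℝ → ℂ} {s c : ℂ} {a b : ℝ} (hs : s ≠ 0)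
    (hff' : ∀ x > 0, HasDerivAt f (f' x) x)
    (hf_top : f =O[atTop] fun x => x ^ (-a)) (ha : s.re < a)
    (hf_bot : f =O[𝓝[>] 0] fun x => x ^ (-b)) (hb : b < s.re)
    (hf' : HasMellin f' (s + 1) c) : HasMellin f s (-c / s) := by
  have hcont : ContinuousOn f (Ioi 0) := fun x hx => (hff' x hx).continuousAt.continuousWithinAt
  have hconv : MellinConvergent f s := mellinConvergent_of_isBigO_rpow
    (hcont.locallyIntegrableOn measurableSet_Ioi) hf_top ha hf_bot hb
  have hpow : ∀ x ∈ Ioi (0 : ℝ), HasDerivAt (fun x : ℝ => (x : ℂ) ^ s / s) ((x : ℂ) ^ (s - 1)) x :=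
    fun x hx => by
      simpa using hasDerivAt_ofReal_cpow_const' (ne_of_gt hx) (r := s - 1)
        fun h => hs (by linear_combination h)
  have hparts := integral_Ioi_mul_deriv_eq_deriv_mul (a := 0) (a' := 0) (b' := 0) hff' hpow
    (hconv.congr (Eventually.of_forall fun x => mul_comm _ _))
    ((hf'.1.div_const s).congr (Eventually.of_forall fun x => by
      simp only [Pi.mul_apply, add_sub_cancel_right, smul_eq_mul]; ring))
    (by simpa [Pi.mul_def, mul_div_assoc] using
      (tendsto_mul_cpow_nhdsGT_zero_of_isBigO hf_bot hb).div_const s)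
    (by simpa [Pi.mul_def, mul_div_assoc] using
      (tendsto_mul_cpow_atTop_of_isBigO hf_top ha).div_const s)
  refine ⟨hconv, ?_⟩
  calc
    _ = ∫ x in Ioi (0 : ℝ), f x * (x : ℂ) ^ (s - 1) := by simp only [mellin, smul_eq_mul, mul_comm]
    _ = -∫ x in Ioi (0 : ℝ), f' x * ((x : ℂ) ^ s / s) := by simpa using hparts
    _ = -(mellin f' (s + 1) / s) := by
      rw [mellin, ← integral_div]
      congr 2 with x
      rw [add_sub_cancel_right, smul_eq_mul]
      ring
    _ = -c / s := by rw [hf'.2, neg_div]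

end Mellin

section LogOneAdd

theorem log_one_add_isBigO_atTop {ε : ℝ} (hε : 0 < ε) :
    (fun x : ℝ => Real.log (1 + x)) =O[atTop] fun x => x ^ ε := by
  have hshift : (fun x : ℝ => 1 + x) =O[atTop] fun x => x :=
    (isLittleO_const_id_atTop (1 : ℝ)).isBigO.add (isBigO_refl _ _)
  exact ((isLittleO_log_rpow_atTop hε).isBigO.comp_tendsto
    (tendsto_atTop_add_const_left _ 1 tendsto_id)).trans
      (hshift.rpow hε.le (eventually_ge_atTop 0))

theorem hasDerivAt_log_one_add {x : ℝ} (hx : 1 + x ≠ 0) :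
    HasDerivAt (fun x : ℝ => Real.log (1 + x)) (1 + x)⁻¹ x := by
  simpa using ((hasDerivAt_id x).const_add 1).log hx

theorem log_one_add_isBigO_nhds_zero :
    (fun x : ℝ => Real.log (1 + x)) =O[𝓝 0] fun x => x := by
  simpa using (hasDerivAt_log_one_add (x := 0) (by norm_num)).isBigO_sub

theorem hasMellin_log_one_add {s : ℂ} (h1 : -1 < s.re) (h0 : s.re < 0) :
    HasMellin (fun x : ℝ => (Real.log (1 + x) : ℂ)) s (-(Gamma (s + 1) * Gamma (-s)) / s) := by
  have hinv := hasMellin_inv_one_add (s := s + 1) (by simpa using by linarith) (by simpa using h0)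
  rw [sub_add_cancel_right] at hinv
  refine hasMellin_of_hasDerivAt (a := s.re / 2) (b := -1) (by rintro rfl; simp at h0)
    (fun x hx => ?_) ?_ (by linarith) ?_ h1 hinv
  · simpa using (hasDerivAt_log_one_add (by positivity : 1 + x ≠ 0)).ofReal_comp
  · exact isBigO_norm_left.1
      (by simpa using log_one_add_isBigO_atTop (by linarith : 0 < -(s.re / 2)))
  · exact isBigO_norm_left.1
      (by simpa using log_one_add_isBigO_nhds_zero.mono nhdsWithin_le_nhds)

theorem mellin_log_one_add {s : ℂ} (h1 : -1 < s.re) (h0 : s.re < 0) :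
    mellin (fun x => (Real.log (1 + x) : ℂ)) s =
      Gamma (-s) * Gamma (-s) * Gamma (1 + s) / Gamma (1 - s) := by
  have hs : s ≠ 0 := by rintro rfl; simp at h0
  have hΓ : Gamma (-s) ≠ 0 := Complex.Gamma_ne_zero_of_re_pos (by simpa using h0)
  rw [(hasMellin_log_one_add h1 h0).2, ← neg_add_eq_sub s 1,
    Complex.Gamma_add_one _ (neg_ne_zero.2 hs), add_comm s]
  field_simp

theorem norm_sin_add_mul_I_sq (x y : ℝ) :
    ‖Complex.sin (x + y * I)‖ ^ 2 = Real.sin x ^ 2 + Real.sinh y ^ 2 := by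
  rw [Complex.sin_add_mul_I, ← Complex.ofReal_sin, ← Complex.ofReal_cos, ← Complex.ofReal_sinh,
    ← Complex.ofReal_cosh, Complex.sq_norm, ← Complex.ofReal_mul, ← Complex.ofReal_mul,
    Complex.normSq_add_mul_I]
  linear_combination Real.sin x ^ 2 * Real.cosh_sq y + Real.sinh y ^ 2 * Real.sin_sq_add_cos_sq x

theorem sin_sq_add_sq_le_norm_sin_pi_mul_sq (σ t : ℝ) :
    Real.sin (Real.pi * σ) ^ 2 + t ^ 2 ≤ ‖Complex.sin (Real.pi * (σ + t * I))‖ ^ 2 := by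
  have hsinh : t ^ 2 ≤ Real.sinh (Real.pi * t) ^ 2 := by
    rw [sq_le_sq, Real.abs_sinh, abs_mul, abs_of_pos Real.pi_pos]
    refine le_trans ?_ (Real.self_le_sinh_iff.2 (by positivity))
    exact le_mul_of_one_le_left (abs_nonneg t) (by linarith [Real.pi_gt_three])
  rw [mul_add, ← mul_assoc, ← Complex.ofReal_mul, ← Complex.ofReal_mul, norm_sin_add_mul_I_sq]
  gcongr

theorem integrable_inv_sq_add_sq {c : ℝ} (hc : c ≠ 0) :
    Integrable fun t : ℝ => (c ^ 2 + t ^ 2)⁻¹ := by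
  refine ((integrable_inv_one_add_sq.comp_div hc).const_mul (c ^ 2)⁻¹).congr
    (Eventually.of_forall fun t => ?_)
  simp only
  rw [← mul_inv, mul_add, mul_one, div_pow, mul_div_cancel₀ _ (pow_ne_zero 2 hc)]

theorem verticalIntegrable_inv_mul_sin {σ : ℝ} (hσ : Real.sin (Real.pi * σ) ≠ 0) :
    Complex.VerticalIntegrable (fun s => (s * Complex.sin (Real.pi * s))⁻¹) σ := by
  have hσ0 : σ ≠ 0 := by rintro rfl; simp at hσ
  have hline (t : ℝ) : ‖(σ + t * I : ℂ)‖ ^ 2 = σ ^ 2 + t ^ 2 := by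
    rw [Complex.sq_norm, Complex.normSq_add_mul_I]
  have hsin := sin_sq_add_sq_le_norm_sin_pi_mul_sq σ
  have hne (t : ℝ) : (σ + t * I : ℂ) * Complex.sin (Real.pi * (σ + t * I)) ≠ 0 :=
    mul_ne_zero (norm_ne_zero_iff.1 (pow_ne_zero_iff two_ne_zero |>.1 (by rw [hline]; positivity)))
      (norm_ne_zero_iff.1 (pow_ne_zero_iff two_ne_zero |>.1
        (lt_of_lt_of_le (by positivity) (hsin t)).ne'))
  refine ((integrable_inv_sq_add_sq hσ0).add (integrable_inv_sq_add_sq hσ)).mono'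
    (Continuous.aestronglyMeasurable (Continuous.inv₀ (by fun_prop) hne))
    (Eventually.of_forall fun t => ?_)
  calc
    _ = ‖(σ + t * I : ℂ)‖⁻¹ * ‖Complex.sin (Real.pi * (σ + t * I))‖⁻¹ := by
      rw [norm_inv, norm_mul, mul_inv]
    -- Both factors are square-integrable along the line, so splitting the product is affordable.
    _ ≤ ‖(σ + t * I : ℂ)‖⁻¹ ^ 2 + ‖Complex.sin (Real.pi * (σ + t * I))‖⁻¹ ^ 2 := by
      nlinarith [sq_nonneg (‖(σ + t * I : ℂ)‖⁻¹ - ‖Complex.sin (Real.pi * (σ + t * I))‖⁻¹),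
        sq_nonneg (‖(σ + t * I : ℂ)‖⁻¹), sq_nonneg (‖Complex.sin (Real.pi * (σ + t * I))‖⁻¹)]
    _ ≤ (σ ^ 2 + t ^ 2)⁻¹ + (Real.sin (Real.pi * σ) ^ 2 + t ^ 2)⁻¹ := by
      rw [inv_pow, inv_pow, hline]
      gcongr
      exact hsin t

theorem verticalIntegrable_mellin_log_one_add {σ : ℝ} (h1 : -1 < σ) (h0 : σ < 0) :
    Complex.VerticalIntegrable (mellin fun x : ℝ => (Real.log (1 + x) : ℂ)) σ := by
  have hsin : Real.sin (Real.pi * σ) ≠ 0 :=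
    (Real.sin_neg_of_neg_of_neg_pi_lt (mul_neg_of_pos_of_neg Real.pi_pos h0)
      (by nlinarith [Real.pi_pos])).ne
  refine ((verticalIntegrable_inv_mul_sin hsin).const_mul (Real.pi : ℂ)).congr
    (Eventually.of_forall fun t => ?_)
  have hreflection (s : ℂ) :
      -(Gamma (s + 1) * Gamma (-s)) / s = Real.pi * (s * Complex.sin (Real.pi * s))⁻¹ := by
    have h := Complex.Gamma_mul_Gamma_one_sub (s + 1)
    rw [sub_add_cancel_right, mul_add, mul_one, Complex.sin_add_pi] at h
    rw [h, div_neg, neg_neg, div_div, mul_comm s, div_eq_mul_inv]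
  simp only
  rw [(hasMellin_log_one_add (by simpa using h1) (by simpa using h0)).2, hreflection]

theorem mellinInv_mellin_log_one_add {σ : ℝ} (h1 : -1 < σ) (h0 : σ < 0) {x : ℝ} (hx : 0 < x) :
    mellinInv σ (mellin fun x : ℝ => (Real.log (1 + x) : ℂ)) x = (Real.log (1 + x) : ℂ) :=
  mellinInv_mellin_eq σ (fun x : ℝ => (Real.log (1 + x) : ℂ)) hx
    (hasMellin_log_one_add (by simpa using h1) (by simpa using h0)).1
    (verticalIntegrable_mellin_log_one_add h1 h0)
    (hasDerivAt_log_one_add (by positivity)).ofReal_comp.continuousAt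

end LogOneAdd

section ComplexMoment

variable {S : Type*} [MeasurableSpace S] {P : Measure S} {X Y : S → ℝ}

/-- The almost surely positive random variable `X` has complex moment `E[X ^ s] = c`, the
expectation being absolutely convergent. Positivity is part of the notion because it makes
`x ↦ x ^ s` multiplicative. -/
structure HasComplexMoment (P : Measure S) (X : S → ℝ) (s c : ℂ) : Prop where
  aemeasurable : AEMeasurable X P
  ae_pos : ∀ᵐ ω ∂P, 0 < X ω
  integrable : Integrable (fun ω => (X ω : ℂ) ^ s) P
  integral_eq : ∫ ω, (X ω : ℂ) ^ s ∂P = c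

theorem HasComplexMoment.mul {s c d : ℂ} (hX : HasComplexMoment P X s c)
    (hY : HasComplexMoment P Y s d) (hXY : IndepFun X Y P) :
    HasComplexMoment P (fun ω => X ω * Y ω) s (c * d) := by
  have hindep : IndepFun (fun ω => (X ω : ℂ) ^ s) (fun ω => (Y ω : ℂ) ^ s) P :=
    hXY.comp (φ := fun x : ℝ => (x : ℂ) ^ s) (ψ := fun x : ℝ => (x : ℂ) ^ s)
      (by fun_prop) (by fun_prop)
  have hmul : (fun ω => (X ω : ℂ) ^ s * (Y ω : ℂ) ^ s) =ᵐ[P]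
      fun ω => ((X ω * Y ω : ℝ) : ℂ) ^ s := by
    filter_upwards [hX.ae_pos, hY.ae_pos] with ω hx hy
    rw [Complex.ofReal_mul, Complex.mul_cpow_ofReal_nonneg hx.le hy.le]
  exact {
    aemeasurable := hX.aemeasurable.mul hY.aemeasurable
    ae_pos := by filter_upwards [hX.ae_pos, hY.ae_pos] with ω hx hy using mul_pos hx hy
    integrable := (hindep.integrable_mul hX.integrable hY.integrable).congr hmul
    integral_eq := by
      rw [← integral_congr_ae hmul, ← hX.integral_eq, ← hY.integral_eq]
      exact hindep.integral_fun_mul_eq_mul_integral hX.integrable.aestronglyMeasurable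
        hY.integrable.aestronglyMeasurable }

/-- `f 0` is left free because Mathlib's gamma density need not vanish at `0`. -/
theorem hasComplexMoment_of_hasLaw_withDensity {f : ℝ → ℝ} {s c : ℂ} (hf : Measurable f)
    (hf_nonneg : ∀ x, 0 ≤ f x) (hf_neg : ∀ x < 0, f x = 0)
    (hX : HasLaw X (volume.withDensity fun x => ENNReal.ofReal (f x)) P)
    (hmellin : HasMellin (fun x => (f x : ℂ)) (s + 1) c) : HasComplexMoment P X s c := by
  have hpow : Measurable fun x : ℝ => (x : ℂ) ^ s := by fun_prop
  have hsupp : ∀ x ∉ Ici (0 : ℝ), f x • (x : ℂ) ^ s = 0 := fun x hx => by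
    rw [hf_neg x (not_le.1 hx), zero_smul]
  have hflip (x : ℝ) : (x : ℂ) ^ (s + 1 - 1) • (f x : ℂ) = f x • (x : ℂ) ^ s := by
    rw [add_sub_cancel_right, smul_eq_mul, mul_comm, Complex.real_smul]
  obtain ⟨hconv, hval⟩ := hmellin
  simp only [MellinConvergent, hflip] at hconv
  simp only [mellin, hflip] at hval
  refine ⟨hX.aemeasurable, ?_, ?_, ?_⟩
  · rw [hX.ae_iff (measurableSet_setOfPred.1 measurableSet_Ioi), ae_withDensity_iff (by fun_prop)]
    filter_upwards [Measure.ae_ne volume (0 : ℝ)] with x hx hfx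
    exact lt_of_le_of_ne (not_lt.1 fun hlt => hfx (by rw [hf_neg x hlt, ENNReal.ofReal_zero]))
      hx.symm
  · have hint : Integrable (fun x : ℝ => (x : ℂ) ^ s)
        (volume.withDensity fun x => ENNReal.ofReal (f x)) := by
      rw [integrable_withDensity_iff_integrable_smul' (by fun_prop) (by simp)]
      simp only [ENNReal.toReal_ofReal (hf_nonneg _)]
      exact (integrableOn_iff_integrable_of_support_subset
        (Function.support_subset_iff'.2 hsupp)).1 ((integrableOn_Ici_iff_integrableOn_Ioi).2 hconv)
    rw [← hX.map_eq] at hint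
    exact hint.comp_aemeasurable hX.aemeasurable
  · refine (hX.integral_comp hpow.aestronglyMeasurable).trans ?_
    rw [integral_withDensity_eq_integral_toReal_smul (by fun_prop) (by simp), ← hval,
      ← integral_Ici_eq_integral_Ioi, setIntegral_eq_integral_of_forall_compl_eq_zero hsupp]
    simp only [ENNReal.toReal_ofReal (hf_nonneg _)]

theorem HasComplexMoment.integrable_prod [SFinite P] {σ : ℝ} {c : ℂ}
    (hX : HasComplexMoment P X (-σ) c) {F : ℂ → ℂ} (hF : Complex.VerticalIntegrable F σ) :
    Integrable (Function.uncurry fun (ω : S) (t : ℝ) =>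
      (X ω : ℂ) ^ (-(σ + t * I)) * F (σ + t * I)) (P.prod volume) := by
  refine (hX.integrable.norm.mul_prod hF.norm).mono' ?_ ?_
  · refine AEStronglyMeasurable.mul (AEMeasurable.aestronglyMeasurable ?_)
      hF.aestronglyMeasurable.comp_snd
    exact (Complex.measurable_ofReal.comp_aemeasurable hX.aemeasurable.comp_fst).pow
      (Measurable.aemeasurable (by fun_prop))
  · filter_upwards [Measure.quasiMeasurePreserving_fst.ae hX.ae_pos] with p hp
    simp [Function.uncurry, Complex.norm_cpow_eq_rpow_re_of_pos hp]

theorem HasComplexMoment.integral_mellinInv [SFinite P] {σ : ℝ} {F M : ℂ → ℂ}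
    (hX : ∀ s : ℂ, s.re = σ → HasComplexMoment P X (-s) (M s))
    (hF : Complex.VerticalIntegrable F σ) :
    Integrable (fun ω => mellinInv σ F (X ω)) P ∧
      Complex.VerticalIntegrable (fun s => M s * F s) σ ∧
      ∫ ω, mellinInv σ F (X ω) ∂P =
        (2 * (Real.pi : ℂ))⁻¹ * ∫ t : ℝ, M (σ + t * I) * F (σ + t * I) := by
  have hint := (hX σ (Complex.ofReal_re σ)).integrable_prod hF
  have hinner (t : ℝ) : ∫ ω, (X ω : ℂ) ^ (-(σ + t * I)) * F (σ + t * I) ∂P =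
      M (σ + t * I) * F (σ + t * I) := by
    rw [integral_mul_const, (hX _ (by simp)).integral_eq]
  refine ⟨hint.integral_prod_left.smul _, ?_, ?_⟩
  · exact hint.integral_prod_right.congr (Eventually.of_forall hinner)
  · simp only [mellinInv, smul_eq_mul]
    rw [integral_smul, integral_integral_swap hint]
    simp only [hinner, Complex.real_smul]
    push_cast
    rw [one_div]

end ComplexMoment

section Laws

variable {S : Type*} [MeasurableSpace S] {P : Measure S} {X : S → ℝ}

theorem hasMellin_gammaPDFReal {a r : ℝ} (hr : 0 < r) {s : ℂ} (hs : -a < s.re) :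
    HasMellin (fun x : ℝ => (gammaPDFReal a r x : ℂ)) (s + 1)
      ((r : ℂ) ^ (-s) * Gamma (a + s) / Gamma a) := by
  have hr' : (r : ℂ) ≠ 0 := Complex.ofReal_ne_zero.2 hr.ne'
  obtain ⟨hconv, hval⟩ := hasMellin_cpow_mul_exp_neg_mul hr (s := s + 1) (w := (a : ℂ) - 1)
    (by simpa using by linarith)
  have hscaled := hasMellin_const_smul hconv ((r : ℂ) ^ (a : ℂ) / Gamma a)
  rw [hval, show s + 1 + ((a : ℂ) - 1) = a + s by ring, neg_add, Complex.cpow_add _ _ hr',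
    Complex.cpow_neg _ (a : ℂ), smul_eq_mul] at hscaled
  have hra : (r : ℂ) ^ (a : ℂ) ≠ 0 := by simp [Complex.cpow_eq_zero_iff, hr']
  convert (hasMellin_congr fun x (hx : 0 < x) => ?_).1 hscaled using 1
  · field_simp
  · simp only [gammaPDFReal, if_pos hx.le, smul_eq_mul]
    push_cast [Complex.ofReal_cpow hr.le, Complex.ofReal_cpow hx.le, Complex.Gamma_ofReal]
    ring

theorem hasComplexMoment_of_hasLaw_gammaMeasure {a r : ℝ} (ha : 0 < a) (hr : 0 < r) {s : ℂ}
    (hs : -a < s.re) (hX : HasLaw X (gammaMeasure a r) P) :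
    HasComplexMoment P X s ((r : ℂ) ^ (-s) * Gamma (a + s) / Gamma a) :=
  hasComplexMoment_of_hasLaw_withDensity (measurable_gammaPDFReal a r) (gammaPDFReal_nonneg ha hr)
    (fun x hx => by simp [gammaPDFReal, hx.not_ge]) hX (hasMellin_gammaPDFReal hr hs)

theorem hasMellin_invGammaPDFReal {α β : ℝ} (hβ : 0 < β) {s : ℂ} (hs : s.re < α) :
    HasMellin (fun y : ℝ => (invGammaPDFReal α β y : ℂ)) (s + 1)
      ((β : ℂ) ^ s * Gamma (α - s) / Gamma α) := by
  have hβ' : (β : ℂ) ≠ 0 := Complex.ofReal_ne_zero.2 hβ.ne'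
  obtain ⟨hconv, hval⟩ := hasMellin_cpow_mul_exp_neg_mul_inv hβ (s := s + 1)
    (w := -((α : ℂ) + 1)) (by simpa using by linarith)
  have hscaled := hasMellin_const_smul hconv ((β : ℂ) ^ (α : ℂ) / Gamma α)
  rw [hval, show s + 1 + -((α : ℂ) + 1) = s - α by ring, neg_sub, Complex.cpow_sub _ _ hβ',
    smul_eq_mul] at hscaled
  have hβα : (β : ℂ) ^ (α : ℂ) ≠ 0 := by simp [Complex.cpow_eq_zero_iff, hβ']
  convert (hasMellin_congr fun y (hy : 0 < y) => ?_).1 hscaled using 1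
  · field_simp
  · simp only [invGammaPDFReal, if_pos hy, smul_eq_mul, Complex.cpow_neg]
    push_cast [Complex.ofReal_cpow hβ.le, Complex.ofReal_cpow hy.le, Complex.Gamma_ofReal]
    ring_nf

theorem measurable_invGammaPDFReal (α β : ℝ) : Measurable (invGammaPDFReal α β) := by
  unfold invGammaPDFReal
  exact Measurable.ite measurableSet_Ioi (by fun_prop) measurable_const

theorem invGammaPDFReal_nonneg {α β : ℝ} (hα : 0 < α) (hβ : 0 < β) (y : ℝ) :
    0 ≤ invGammaPDFReal α β y := by
  unfold invGammaPDFReal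
  split_ifs <;> positivity

theorem hasComplexMoment_of_hasLaw_invGammaMeasure {α β : ℝ} (hα : 0 < α) (hβ : 0 < β) {s : ℂ}
    (hs : s.re < α) (hX : HasLaw X (invGammaMeasure α β) P) :
    HasComplexMoment P X s ((β : ℂ) ^ s * Gamma (α - s) / Gamma α) :=
  hasComplexMoment_of_hasLaw_withDensity (measurable_invGammaPDFReal α β)
    (invGammaPDFReal_nonneg hα hβ) (fun y hy => by simp [invGammaPDFReal, hy.not_gt]) hX
    (hasMellin_invGammaPDFReal hβ hs)

end Laws


section Capacity

variable {S : Type*} [MeasurableSpace S] {P : Measure S} {X : S → ℝ}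

theorem integral_log_one_add_eq [SFinite P] {σ : ℝ} (h1 : -1 < σ) (h0 : σ < 0) {M : ℂ → ℂ}
    (hX : ∀ s : ℂ, s.re = σ → HasComplexMoment P X (-s) (M s)) :
    Integrable (fun ω => Real.log (1 + X ω)) P ∧
      Complex.VerticalIntegrable (fun s => M s * mellin (fun x => (Real.log (1 + x) : ℂ)) s) σ ∧
      ((∫ ω, Real.log (1 + X ω) ∂P : ℝ) : ℂ) = (2 * (Real.pi : ℂ))⁻¹ *
        ∫ t : ℝ, M (σ + t * I) * mellin (fun x => (Real.log (1 + x) : ℂ)) (σ + t * I) := by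
  obtain ⟨hint, hvert, hval⟩ :=
    HasComplexMoment.integral_mellinInv hX (verticalIntegrable_mellin_log_one_add h1 h0)
  have hinv : (fun ω => mellinInv σ (mellin fun x => (Real.log (1 + x) : ℂ)) (X ω)) =ᵐ[P]
      fun ω => (Real.log (1 + X ω) : ℂ) := by
    filter_upwards [(hX σ (Complex.ofReal_re σ)).ae_pos] with ω hω
    exact mellinInv_mellin_log_one_add h1 h0 hω
  refine ⟨?_, hvert, ?_⟩
  · simpa using (hint.congr hinv).re
  · rw [← hval, integral_congr_ae hinv, integral_complex_ofReal]

theorem meijerG_eq_of_forall_meijerGLine_eq {p q m n : ℕ} {a : Fin p → ℂ} {b : Fin q → ℂ}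
    {z c : ℂ} (hex : ∃ σ, SeparatesPoles m n a b σ)
    (hline : ∀ σ, SeparatesPoles m n a b σ → meijerGLine m n a b z σ = c) :
    meijerG m n a b z = c := by
  rw [meijerG, dif_pos hex]
  exact hline _ hex.choose_spec

theorem ergodicCapacity_eq_meijerG [SFinite P] {p q m n : ℕ} {a : Fin p → ℂ} {b : Fin q → ℂ}
    {z : ℂ} {C : ℝ} (hC : C ≠ 0) {W : ℂ → ℂ} (hex : ∃ σ, SeparatesPoles m n a b σ)
    (hstrip : ∀ σ, SeparatesPoles m n a b σ → -1 < σ ∧ σ < 0)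
    (hX : ∀ s : ℂ, SeparatesPoles m n a b s.re → HasComplexMoment P X (-s) (C * W s))
    (hG : ∀ s : ℂ, SeparatesPoles m n a b s.re →
      meijerGIntegrand m n a b z s = W s * mellin (fun x => (Real.log (1 + x) : ℂ)) s)
    (BW : ℝ) :
    Integrable (fun ω => Real.logb 2 (1 + X ω)) P ∧ MeijerGWellDefined m n a b z ∧
      (ergodicCapacity P BW X : ℂ) =
        BW * C * ((Real.log 2 : ℝ) : ℂ)⁻¹ * meijerG m n a b z := by
  have hC' : (C : ℂ) ≠ 0 := Complex.ofReal_ne_zero.2 hC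
  have hlog (σ : ℝ) (hσ : SeparatesPoles m n a b σ) :=
    integral_log_one_add_eq (hstrip σ hσ).1 (hstrip σ hσ).2 fun s hs => hX s (by rwa [hs])
  have hintegrand (σ : ℝ) (hσ : SeparatesPoles m n a b σ) (t : ℝ) :
      C * W (σ + t * I) * mellin (fun x => (Real.log (1 + x) : ℂ)) (σ + t * I) =
        C * meijerGIntegrand m n a b z (σ + t * I) := by
    rw [hG _ (by simpa using hσ), mul_assoc]
  have hline (σ : ℝ) (hσ : SeparatesPoles m n a b σ) :
      meijerGLine m n a b z σ = (C : ℂ)⁻¹ * ((∫ ω, Real.log (1 + X ω) ∂P : ℝ) : ℂ) := by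
    rw [(hlog σ hσ).2.2]
    simp only [hintegrand σ hσ]
    rw [integral_const_mul, mul_left_comm _ (C : ℂ), inv_mul_cancel_left₀ hC', meijerGLine]
  have hval := meijerG_eq_of_forall_meijerGLine_eq hex hline
  refine ⟨?_, ⟨hex, fun σ hσ => ⟨?_, (hline σ hσ).trans hval.symm⟩⟩, ?_⟩
  · obtain ⟨σ, hσ⟩ := hex
    exact (hlog σ hσ).1.div_const _
  · have hvert := (hlog σ hσ).2.1.congr (Eventually.of_forall (hintegrand σ hσ))
    simpa [hC'] using hvert.const_mul (C : ℂ)⁻¹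
  · simp only [hval, ergodicCapacity, Real.logb, integral_div]
    push_cast
    field_simp

end Capacity

section Shadowing

theorem separatesPoles_double_iff {m₁ m₂ α₁ α₂ σ : ℝ} :
    SeparatesPoles 4 3 ![1 - (α₂ : ℂ), 1 - (α₁ : ℂ), 0, 1] ![(m₁ : ℂ), (m₂ : ℂ), 0, 0] σ ↔
      (σ < m₁ ∧ σ < m₂ ∧ σ < 0) ∧ -α₂ < σ ∧ -α₁ < σ ∧ -1 < σ := by
  simp [SeparatesPoles, Fin.forall_fin_succ]

theorem separatesPoles_single_iff {m₁ m₂ α σ : ℝ} :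
    SeparatesPoles 4 2 ![1 - (α : ℂ), 0, 1] ![(m₁ : ℂ), (m₂ : ℂ), 0, 0] σ ↔
      (σ < m₁ ∧ σ < m₂ ∧ σ < 0) ∧ -α < σ ∧ -1 < σ := by
  simp [SeparatesPoles, Fin.forall_fin_succ]

theorem exists_separatesPoles_double {m₁ m₂ α₁ α₂ : ℝ} (hm₁ : 0 < m₁) (hm₂ : 0 < m₂)
    (hα₁ : 0 < α₁) (hα₂ : 0 < α₂) :
    ∃ σ, SeparatesPoles 4 3 ![1 - (α₂ : ℂ), 1 - (α₁ : ℂ), 0, 1] ![(m₁ : ℂ), (m₂ : ℂ), 0, 0] σ := by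
  obtain ⟨σ, hleft, hright⟩ : ∃ σ, max (-α₂) (max (-α₁) (-1)) < σ ∧ σ < 0 :=
    exists_between (by simp [hα₁, hα₂])
  rw [max_lt_iff, max_lt_iff] at hleft
  exact ⟨σ, separatesPoles_double_iff.2 ⟨⟨hright.trans hm₁, hright.trans hm₂, hright⟩, hleft⟩⟩

theorem exists_separatesPoles_single {m₁ m₂ α : ℝ} (hm₁ : 0 < m₁) (hm₂ : 0 < m₂) (hα : 0 < α) :
    ∃ σ, SeparatesPoles 4 2 ![1 - (α : ℂ), 0, 1] ![(m₁ : ℂ), (m₂ : ℂ), 0, 0] σ := by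
  obtain ⟨σ, hleft, hright⟩ : ∃ σ, max (-α) (-1) < σ ∧ σ < 0 := exists_between (by simp [hα])
  rw [max_lt_iff] at hleft
  exact ⟨σ, separatesPoles_single_iff.2 ⟨⟨hright.trans hm₁, hright.trans hm₂, hright⟩, hleft⟩⟩

theorem meijerGIntegrand_double (m₁ m₂ α₁ α₂ z s : ℂ) :
    meijerGIntegrand 4 3 ![1 - α₂, 1 - α₁, 0, 1] ![m₁, m₂, 0, 0] z s =
      Gamma (m₁ - s) * Gamma (m₂ - s) * Gamma (α₁ + s) * Gamma (α₂ + s) * z ^ s *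
        (Gamma (-s) * Gamma (-s) * Gamma (1 + s) / Gamma (1 - s)) := by
  simp [meijerGIntegrand, Fin.prod_univ_succ, div_eq_mul_inv, mul_comm, mul_left_comm,
    mul_assoc]

theorem meijerGIntegrand_single (m₁ m₂ α z s : ℂ) :
    meijerGIntegrand 4 2 ![1 - α, 0, 1] ![m₁, m₂, 0, 0] z s =
      Gamma (m₁ - s) * Gamma (m₂ - s) * Gamma (α + s) * z ^ s *
        (Gamma (-s) * Gamma (-s) * Gamma (1 + s) / Gamma (1 - s)) := by
  simp [meijerGIntegrand, Fin.prod_univ_succ, div_eq_mul_inv, mul_comm, mul_left_comm,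
    mul_assoc]

theorem constDS_pos {m₁ m₂ α₁ α₂ : ℝ} (hm₁ : 0 < m₁) (hm₂ : 0 < m₂) (hα₁ : 0 < α₁)
    (hα₂ : 0 < α₂) : 0 < constDS m₁ m₂ α₁ α₂ := by
  unfold constDS
  positivity

theorem constSS_pos {m₁ m₂ α : ℝ} (hm₁ : 0 < m₁) (hm₂ : 0 < m₂) (hα : 0 < α) :
    0 < constSS m₁ m₂ α := by
  unfold constSS
  positivity

variable {S : Type*} [MeasurableSpace S] {P : Measure S} {m₁ m₂ Ω : ℝ}

theorem isProbabilityMeasure_of_hasLaw_nakagamiSqMeasure {X : S → ℝ} {m : ℝ} (hm : 0 < m)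
    (hΩ : 0 < Ω) (hX : HasLaw X (nakagamiSqMeasure m Ω) P) : IsProbabilityMeasure P :=
  have : IsProbabilityMeasure (nakagamiSqMeasure m Ω) :=
    isProbabilityMeasure_gammaMeasure hm (div_pos hm hΩ)
  hX.isProbabilityMeasure

theorem hasComplexMoment_neg_of_hasLaw_nakagamiSqMeasure {X : S → ℝ} {m : ℝ} (hm : 0 < m)
    (hΩ : 0 < Ω) {s : ℂ} (hs : s.re < m) (hX : HasLaw X (nakagamiSqMeasure m Ω) P) :
    HasComplexMoment P X (-s) ((m : ℂ) ^ s / (Ω : ℂ) ^ s * Gamma (m - s) / Gamma m) := by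
  simpa only [neg_neg, ← sub_eq_add_neg, Complex.ofReal_div,
    Complex.div_cpow_ofReal_nonneg hm.le hΩ.le] using
    hasComplexMoment_of_hasLaw_gammaMeasure hm (div_pos hm hΩ) (s := -s) (by simpa using hs) hX

theorem ofReal_mul_div_sq_mul_cpow {x y a b : ℝ} (hx : 0 ≤ x) (hy : 0 ≤ y) (ha : 0 ≤ a)
    (hb : 0 ≤ b) (s : ℂ) :
    ((x * y / (a ^ 2 * b) : ℝ) : ℂ) ^ s =
      (x : ℂ) ^ s * (y : ℂ) ^ s / ((a : ℂ) ^ s * (a : ℂ) ^ s * (b : ℂ) ^ s) := by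
  rw [pow_two, Complex.ofReal_div, Complex.div_cpow_ofReal_nonneg (by positivity) (by positivity),
    Complex.ofReal_mul, Complex.ofReal_mul, Complex.mul_cpow_ofReal_nonneg hx hy,
    Complex.mul_cpow_ofReal_nonneg (by positivity) hb, Complex.ofReal_mul,
    Complex.mul_cpow_ofReal_nonneg ha ha]

theorem IsDoubleShadowing.hasComplexMoment_snrDS {N₁ N₂ I₁ I₂ : S → ℝ} {α₁ α₂ β₁ β₂ : ℝ}
    (h : IsDoubleShadowing P N₁ N₂ I₁ I₂ m₁ m₂ Ω α₁ α₂ β₁ β₂) (hm₁ : 0 < m₁) (hm₂ : 0 < m₂)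
    (hΩ : 0 < Ω) (hα₁ : 0 < α₁) (hα₂ : 0 < α₂) (hβ₁ : 0 < β₁) (hβ₂ : 0 < β₂) {s : ℂ}
    (hsm₁ : s.re < m₁) (hsm₂ : s.re < m₂) (hsα₁ : -α₁ < s.re) (hsα₂ : -α₂ < s.re) :
    HasComplexMoment P (snrDS N₁ N₂ I₁ I₂) (-s)
      (constDS m₁ m₂ α₁ α₂ *
        (Gamma (m₁ - s) * Gamma (m₂ - s) * Gamma (α₁ + s) * Gamma (α₂ + s) *
          ((m₁ * m₂ / (Ω ^ 2 * (β₁ * β₂)) : ℝ) : ℂ) ^ s)) := by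
  have hN₁ := hasComplexMoment_neg_of_hasLaw_nakagamiSqMeasure hm₁ hΩ hsm₁ h.law_N₁
  have hN₂ := hasComplexMoment_neg_of_hasLaw_nakagamiSqMeasure hm₂ hΩ hsm₂ h.law_N₂
  have hI₁ := hasComplexMoment_of_hasLaw_invGammaMeasure hα₁ hβ₁ (s := -s)
    (by simpa using neg_lt.1 hsα₁) h.law_I₁
  have hI₂ := hasComplexMoment_of_hasLaw_invGammaMeasure hα₂ hβ₂ (s := -s)
    (by simpa using neg_lt.1 hsα₂) h.law_I₂
  have hγ : HasComplexMoment P (snrDS N₁ N₂ I₁ I₂) (-s) _ :=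
    (hN₁.mul hI₁ h.indep₁).mul (hN₂.mul hI₂ h.indep₂) h.indep
  convert hγ using 1
  rw [ofReal_mul_div_sq_mul_cpow hm₁.le hm₂.le hΩ.le (mul_pos hβ₁ hβ₂).le, Complex.ofReal_mul,
    Complex.mul_cpow_ofReal_nonneg hβ₁.le hβ₂.le, constDS]
  push_cast [Complex.Gamma_ofReal, Complex.cpow_neg, sub_neg_eq_add]
  ring

theorem IsSingleShadowing.hasComplexMoment_snrSS {N₁ N₂ I : S → ℝ} {α β : ℝ}
    (h : IsSingleShadowing P N₁ N₂ I m₁ m₂ Ω α β) (hm₁ : 0 < m₁) (hm₂ : 0 < m₂)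
    (hΩ : 0 < Ω) (hα : 0 < α) (hβ : 0 < β) {s : ℂ} (hsm₁ : s.re < m₁) (hsm₂ : s.re < m₂)
    (hsα : -α < s.re) :
    HasComplexMoment P (snrSS N₁ N₂ I) (-s)
      (constSS m₁ m₂ α *
        (Gamma (m₁ - s) * Gamma (m₂ - s) * Gamma (α + s) *
          ((m₁ * m₂ / (Ω ^ 2 * β) : ℝ) : ℂ) ^ s)) := by
  have hN₁ := hasComplexMoment_neg_of_hasLaw_nakagamiSqMeasure hm₁ hΩ hsm₁ h.law_N₁
  have hN₂ := hasComplexMoment_neg_of_hasLaw_nakagamiSqMeasure hm₂ hΩ hsm₂ h.law_N₂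
  have hI := hasComplexMoment_of_hasLaw_invGammaMeasure hα hβ (s := -s)
    (by simpa using neg_lt.1 hsα) h.law_I
  have hN := hN₁.mul hN₂ h.indep_N
  simp only [← mul_pow] at hN
  have hγ : HasComplexMoment P (snrSS N₁ N₂ I) (-s) _ := hN.mul hI h.indep
  convert hγ using 1
  rw [ofReal_mul_div_sq_mul_cpow hm₁.le hm₂.le hΩ.le hβ.le, constSS]
  push_cast [Complex.Gamma_ofReal, Complex.cpow_neg, sub_neg_eq_add]
  ring

end Shadowing

theorem mainTheorem6_general {S : Type*} [MeasurableSpace S] (P : Measure S)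
    (BW m₁ m₂ Ω : ℝ) (hm₁ : 0 < m₁) (hm₂ : 0 < m₂) (hΩ : 0 < Ω) :
    (∀ (N₁ N₂ I₁ I₂ : S → ℝ) (α₁ α₂ β₁ β₂ γbar γtilde : ℝ),
      0 < α₁ → 0 < α₂ → 0 < β₁ → 0 < β₂ →
      IsDoubleShadowing P N₁ N₂ I₁ I₂ m₁ m₂ Ω α₁ α₂ β₁ β₂ →
      γbar = Ω ^ 2 * (β₁ * β₂) → γtilde = m₁ * m₂ / γbar →
      Integrable (fun ω => Real.logb 2 (1 + snrDS N₁ N₂ I₁ I₂ ω)) P ∧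
        MeijerGWellDefined 4 3
          ![1 - (α₂ : ℂ), 1 - (α₁ : ℂ), 0, 1] ![(m₁ : ℂ), (m₂ : ℂ), 0, 0] (γtilde : ℂ) ∧
        (ergodicCapacity P BW (snrDS N₁ N₂ I₁ I₂) : ℂ) =
          BW * constDS m₁ m₂ α₁ α₂ * ((Real.log 2 : ℝ) : ℂ)⁻¹ *
            meijerG 4 3
              ![1 - (α₂ : ℂ), 1 - (α₁ : ℂ), 0, 1] ![(m₁ : ℂ), (m₂ : ℂ), 0, 0] (γtilde : ℂ)) ∧
    (∀ (N₁ N₂ I : S → ℝ) (α β γbar γtilde : ℝ),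
      0 < α → 0 < β →
      IsSingleShadowing P N₁ N₂ I m₁ m₂ Ω α β →
      γbar = Ω ^ 2 * β → γtilde = m₁ * m₂ / γbar →
      Integrable (fun ω => Real.logb 2 (1 + snrSS N₁ N₂ I ω)) P ∧
        MeijerGWellDefined 4 2
          ![1 - (α : ℂ), 0, 1] ![(m₁ : ℂ), (m₂ : ℂ), 0, 0] (γtilde : ℂ) ∧
        (ergodicCapacity P BW (snrSS N₁ N₂ I) : ℂ) =
          BW * constSS m₁ m₂ α * ((Real.log 2 : ℝ) : ℂ)⁻¹ *
            meijerG 4 2 ![1 - (α : ℂ), 0, 1] ![(m₁ : ℂ), (m₂ : ℂ), 0, 0] (γtilde : ℂ)) := by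
  constructor
  · rintro N₁ N₂ I₁ I₂ α₁ α₂ β₁ β₂ _ _ hα₁ hα₂ hβ₁ hβ₂ h rfl rfl
    have := isProbabilityMeasure_of_hasLaw_nakagamiSqMeasure hm₁ hΩ h.law_N₁
    refine ergodicCapacity_eq_meijerG (W := fun s => Gamma (m₁ - s) * Gamma (m₂ - s) *
        Gamma (α₁ + s) * Gamma (α₂ + s) * ((m₁ * m₂ / (Ω ^ 2 * (β₁ * β₂)) : ℝ) : ℂ) ^ s)
      (constDS_pos hm₁ hm₂ hα₁ hα₂).ne' (exists_separatesPoles_double hm₁ hm₂ hα₁ hα₂)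
      (fun σ hσ => ?_) (fun s hs => ?_) (fun s hs => ?_) BW
    · obtain ⟨⟨-, -, h0⟩, -, -, h1⟩ := separatesPoles_double_iff.1 hσ
      exact ⟨h1, h0⟩
    · obtain ⟨⟨hsm₁, hsm₂, -⟩, hsα₂, hsα₁, -⟩ := separatesPoles_double_iff.1 hs
      exact h.hasComplexMoment_snrDS hm₁ hm₂ hΩ hα₁ hα₂ hβ₁ hβ₂ hsm₁ hsm₂ hsα₁ hsα₂
    · obtain ⟨⟨-, -, h0⟩, -, -, h1⟩ := separatesPoles_double_iff.1 hs
      rw [meijerGIntegrand_double, mellin_log_one_add h1 h0]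
  · rintro N₁ N₂ I α β _ _ hα hβ h rfl rfl
    have := isProbabilityMeasure_of_hasLaw_nakagamiSqMeasure hm₁ hΩ h.law_N₁
    refine ergodicCapacity_eq_meijerG (W := fun s => Gamma (m₁ - s) * Gamma (m₂ - s) *
        Gamma (α + s) * ((m₁ * m₂ / (Ω ^ 2 * β) : ℝ) : ℂ) ^ s)
      (constSS_pos hm₁ hm₂ hα).ne' (exists_separatesPoles_single hm₁ hm₂ hα)
      (fun σ hσ => ?_) (fun s hs => ?_) (fun s hs => ?_) BW
    · obtain ⟨⟨-, -, h0⟩, -, h1⟩ := separatesPoles_single_iff.1 hσ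
      exact ⟨h1, h0⟩
    · obtain ⟨⟨hsm₁, hsm₂, -⟩, hsα, -⟩ := separatesPoles_single_iff.1 hs
      exact h.hasComplexMoment_snrSS hm₁ hm₂ hΩ hα hβ hsm₁ hsm₂ hsα
    · obtain ⟨⟨-, -, h0⟩, -, h1⟩ := separatesPoles_single_iff.1 hs
      rw [meijerGIntegrand_single, mellin_log_one_add h1 h0]

end ShadowedDoubleScattering

theorem mainTheorem6 {S : Type*} [MeasurableSpace S] (P : MeasureTheory.Measure S)
    [MeasureTheory.IsProbabilityMeasure P]
    (BW m₁ m₂ Ω : ℝ) (hm₁ : 0 < m₁) (hm₂ : 0 < m₂) (hΩ : 0 < Ω) :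
    -- double shadowing
    (∀ (N₁ N₂ I₁ I₂ : S → ℝ) (α₁ α₂ β₁ β₂ γbar γtilde : ℝ),
      1 < α₁ → 1 < α₂ → 0 < β₁ → 0 < β₂ →
      ShadowedDoubleScattering.IsDoubleShadowing P N₁ N₂ I₁ I₂ m₁ m₂ Ω α₁ α₂ β₁ β₂ →
      γbar = Ω ^ 2 * (β₁ * β₂) → γtilde = m₁ * m₂ / γbar →
      MeasureTheory.Integrable (fun ω =>
          Real.logb 2 (1 + ShadowedDoubleScattering.snrDS N₁ N₂ I₁ I₂ ω)) P ∧
        ShadowedDoubleScattering.MeijerGWellDefined 4 3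
          ![1 - (α₂ : ℂ), 1 - (α₁ : ℂ), 0, 1] ![(m₁ : ℂ), (m₂ : ℂ), 0, 0] (γtilde : ℂ) ∧
        ((ShadowedDoubleScattering.ergodicCapacity P BW
            (ShadowedDoubleScattering.snrDS N₁ N₂ I₁ I₂) : ℝ) : ℂ) =
          (BW : ℂ) * (ShadowedDoubleScattering.constDS m₁ m₂ α₁ α₂ : ℂ) *
            ((Real.log 2 : ℝ) : ℂ)⁻¹ *
            ShadowedDoubleScattering.meijerG 4 3
              ![1 - (α₂ : ℂ), 1 - (α₁ : ℂ), 0, 1] ![(m₁ : ℂ), (m₂ : ℂ), 0, 0] (γtilde : ℂ)) ∧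
    -- single shadowing
    (∀ (N₁ N₂ I : S → ℝ) (α β γbar γtilde : ℝ),
      1 < α → 0 < β →
      ShadowedDoubleScattering.IsSingleShadowing P N₁ N₂ I m₁ m₂ Ω α β →
      γbar = Ω ^ 2 * β → γtilde = m₁ * m₂ / γbar →
      MeasureTheory.Integrable (fun ω =>
          Real.logb 2 (1 + ShadowedDoubleScattering.snrSS N₁ N₂ I ω)) P ∧
        ShadowedDoubleScattering.MeijerGWellDefined 4 2
          ![1 - (α : ℂ), 0, 1] ![(m₁ : ℂ), (m₂ : ℂ), 0, 0] (γtilde : ℂ) ∧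
        ((ShadowedDoubleScattering.ergodicCapacity P BW
            (ShadowedDoubleScattering.snrSS N₁ N₂ I) : ℝ) : ℂ) =
          (BW : ℂ) * (ShadowedDoubleScattering.constSS m₁ m₂ α : ℂ) *
            ((Real.log 2 : ℝ) : ℂ)⁻¹ *
            ShadowedDoubleScattering.meijerG 4 2
              ![1 - (α : ℂ), 0, 1] ![(m₁ : ℂ), (m₂ : ℂ), 0, 0] (γtilde : ℂ)) := by
  have h := ShadowedDoubleScattering.mainTheorem6_general P BW m₁ m₂ Ω hm₁ hm₂ hΩ
  exact ⟨fun N₁ N₂ I₁ I₂ α₁ α₂ β₁ β₂ γbar γtilde hα₁ hα₂ =>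
      h.1 N₁ N₂ I₁ I₂ α₁ α₂ β₁ β₂ γbar γtilde (zero_lt_one.trans hα₁) (zero_lt_one.trans hα₂),
    fun N₁ N₂ I α β γbar γtilde hα => h.2 N₁ N₂ I α β γbar γtilde (zero_lt_one.trans hα)⟩
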